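/- Let $G$ be a group acting by homeomorphisms on a Cantor set $X$ (a nonempty, compact, totally disconnected metric space without isolated points). Let $\mathcal K(X)$ be the space of nonempty compact subsets of $X$ with the Hausdorff metric and the induced action $g\cdot K=g(K)$. For $Y=X$ or $Y=\mathcal K(X)$ let $\mathcal M_G(Y)$ be the set of $G$-invariant Borel probability measures on $Y$. An invariant random compact (IRC) is an element of $\mathcal M_G(\mathcal K(X))$. It is nonfinitary if almost every compact set is infinite, and the action is IC-rigid if the only nonfinitary IRC is the Dirac mass $\delta_X$ at the compact set $X$. A tree structure on $X$ is a sequence $(\mathcal C_i)_{i}$ of finite partitions of $X$ into nonempty clopen sets such that (i) $\mathcal C_{i+1}$ refines $\mathcal C_i$ for every $i$; (ii) $\max_{C\in\mathcal C_i}\operatorname{diam}(C)\to0$ as $i\to\infty$; (iii) for all $k$ and all $C\in\mathcal C_k$, $\inf_{n\ge k}|\{D\in\mathcal C_n:D\subset C\}|/|\mathcal C_n|>0$. The group $G$ acts deeply transitively on $X$ if there is a tree structure $(\mathcal C_i)_i$ on $X$ such that for every $i$ and all subsets $\mathcal A,\mathcal B\subset\mathcal C_i$ with $|\mathcal A|=|\mathcal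 B|$ there is $g\in G$ with $\{g(A):A\in\mathcal A\}=\mathcal B$. Suppose that $G$ acts deeply transitively on the Cantor set $X$. Then: (1) The action is IC-rigid. (2) If $\mathcal M_G(X)=\emptyset$, then the induced action of $G$ on $\mathcal K(X)$ is uniquely ergodic, with unique invariant probability measure $\delta_X$; that is, $\mathcal M_G(\mathcal K(X))=\{\delta_X\}$. (3) If $\mathcal M_G(X)\ne\emptyset$, then the simplex $\mathcal M_G(\mathcal K(X))$ is isomorphic, as a convex set, to the infinite-dimensional probability simplex $\Delta(\mathbb N)=\{(c_k)_{k\ge0}: c_k\ge0,\ \sum_{k=0}^\infty c_k=1\}$. Explicitly, for every $\mu\in\mathcal M_G(X)$ the map $$(c_k)_{k\ge0}\ \longmapsto\ c_0\,\delta_X+\sum_{k=1}^\infty c_k\,\mu^{\mathcal K}_k$$ is a bijection from $\Delta(\mathbb N)$ onto $\mathcal M_G(\mathcal K(X))$ that preserves convex combinations, where $\mu^{\mathcal K}_k$ is the pushforward of the product measure $\mu^{\otimes k}$ under $X^k\to\mathcal K(X)$, $(x_1,\dots,x_k)\mapsto\{x_1,\dots,x_k\}$. -/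

import Mathlib

open Set Filter Topology MeasureTheory TopologicalSpace
open scoped NNReal ENNReal

noncomputable section

namespace IRC

/-- The space `K(X) = NonemptyCompacts X` of nonempty compact subsets of `X`, with the Vietoris
topology (which is the topology of the Hausdorff metric), carries its Borel sigma-algebra. -/
instance borelNonemptyCompacts (X : Type*) [TopologicalSpace X] :
    MeasurableSpace (NonemptyCompacts X) := borel _

instance borelSpaceNonemptyCompacts (X : Type*) [TopologicalSpace X] :
    BorelSpace (NonemptyCompacts X) := ⟨rfl⟩

/-- The action of `G` on `K(X)` induced by a continuous action on `X`: `g • K = g(K)`. -/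
instance actionNonemptyCompacts (G X : Type*) [Group G] [TopologicalSpace X] [MulAction G X]
    [ContinuousConstSMul G X] : MulAction G (NonemptyCompacts X) where
  smul g K := K.map (fun x => g • x) (continuous_const_smul g)
  one_smul K := by
    apply NonemptyCompacts.ext
    change (fun x => (1 : G) • x) '' (K : Set X) = K
    simp
  mul_smul g h K := by
    apply NonemptyCompacts.ext
    change (fun x => (g * h) • x) '' (K : Set X) =
      (fun x => g • x) '' ((fun x => h • x) '' (K : Set X))
    rw [image_image]
    simp only [mul_smul]

/-- The set of `G`-invariant Borel probability measures on `Y`. -/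
def invariantProb (G Y : Type*) [Group G] [MulAction G Y] [MeasurableSpace Y] :
    Set (Measure Y) :=
  {μ | IsProbabilityMeasure μ ∧ SMulInvariantMeasure G Y μ}

/-- The invariant random compacts of the action of `G` on `X`. -/
def invariantRandomCompacts (G X : Type*) [Group G] [TopologicalSpace X] [MulAction G X]
    [ContinuousConstSMul G X] : Set (Measure (NonemptyCompacts X)) :=
  invariantProb G (NonemptyCompacts X)

/-- A measure on `K(X)` is nonfinitary if almost every compact set is infinite. -/
def Nonfinitary {X : Type*} [TopologicalSpace X] (ν : Measure (NonemptyCompacts X)) : Prop :=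
  ∀ᵐ K : NonemptyCompacts X ∂ν, (K : Set X).Infinite

/-- The Dirac mass `δ_X` at the compact set `X`. -/
def diracWhole (X : Type*) [TopologicalSpace X] [CompactSpace X] [Nonempty X] :
    Measure (NonemptyCompacts X) :=
  Measure.dirac ⊤

/-- The action is IC-rigid: `δ_X` is the only nonfinitary invariant random compact. -/
def ICRigid (G X : Type*) [Group G] [TopologicalSpace X] [CompactSpace X] [Nonempty X]
    [MulAction G X] [ContinuousConstSMul G X] : Prop :=
  {ν | ν ∈ invariantRandomCompacts G X ∧ Nonfinitary ν} = {diracWhole X}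

/-- The map `ρ_k : X^k → K(X)`, `(x₁, …, x_k) ↦ {x₁, …, x_k}`, for `k ≥ 1`. -/
def rho (X : Type*) [TopologicalSpace X] (k : ℕ) [NeZero k] (x : Fin k → X) :
    NonemptyCompacts X where
  carrier := range x
  isCompact' := (finite_range x).isCompact
  nonempty' := range_nonempty x

/-- The pushforward of the product measure `μ^{⊗k}` under `ρ_k`. -/
def muK {X : Type*} [TopologicalSpace X] [MeasurableSpace X] (μ : Measure X) (k : ℕ) [NeZero k] :
    Measure (NonemptyCompacts X) :=
  Measure.map (rho X k) (Measure.pi fun _ : Fin k => μ)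

/-- The infinite-dimensional probability simplex: nonnegative sequences of total sum `1`. -/
def probSimplex : Set (ℕ → ℝ≥0) := {c | HasSum c 1}

/-- A bijection between two convex sets preserves convex combinations. -/
def PreservesConvexComb {E F : Type*} [AddCommMonoid E] [Module ℝ≥0 E] [AddCommMonoid F]
    [Module ℝ≥0 F] {S : Set E} {T : Set F} (Φ : S ≃ T) : Prop :=
  ∀ (x y z : S) (s t : ℝ≥0), s + t = 1 → (z : E) = s • (x : E) + t • (y : E) →
    (Φ z : F) = s • (Φ x : F) + t • (Φ y : F)

/-- A tree structure on `X`: a refining sequence of finite clopen partitions, with diameters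
tending to `0`, such that every cell contains a proportion of the cells of the later partitions
which is bounded away from `0`. The levels are numbered from `0`. -/
structure TreeStructure (X : Type*) [MetricSpace X] where
  /-- The cells of the `i`-th partition. -/
  cells : ℕ → Finset (Set X)
  isClopen : ∀ i, ∀ C ∈ cells i, IsClopen C
  nonempty : ∀ i, ∀ C ∈ cells i, C.Nonempty
  pairwiseDisjoint : ∀ i, (cells i : Set (Set X)).PairwiseDisjoint id
  sUnion_eq : ∀ i, ⋃₀ (cells i : Set (Set X)) = univ
  refines : ∀ i, ∀ D ∈ cells (i + 1), ∃ C ∈ cells i, D ⊆ C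
  tendsto_diam : Tendsto (fun i => (cells i).sup Metric.ediam) atTop (𝓝 0)
  density_pos : ∀ k, ∀ C ∈ cells k,
    0 < ⨅ n : Ici k, (({D | D ∈ cells n ∧ D ⊆ C}.ncard : ℝ) / ((cells n).card : ℝ))

/-- Deep transitivity with respect to a tree structure: at each level, `G` acts transitively on
the `r`-element sets of cells, for every `r`. -/
def DeeplyTransitiveWith (G : Type*) {X : Type*} [Group G] [MetricSpace X] [MulAction G X]
    (T : TreeStructure X) : Prop :=
  ∀ (i : ℕ) (A B : Finset (Set X)), A ⊆ T.cells i → B ⊆ T.cells i → A.card = B.card →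
    ∃ g : G, (fun C : Set X => (fun x => g • x) '' C) '' (A : Set (Set X)) = (B : Set (Set X))

/-- Deep transitivity: some tree structure is a witness. -/
def DeeplyTransitive (G X : Type*) [Group G] [MetricSpace X] [MulAction G X] : Prop :=
  ∃ T : TreeStructure X, DeeplyTransitiveWith G T

end IRC

end

/-! At level `n` replace `K` by the set of cells it meets. For an invariant `ν`, deep transitivity
makes this random set uniform among `r`-element sets of cells, conditionally on having `r` elements.
So the probability that `r` cells are met, all in a given `S`, is the probability that `r` are met
times a ratio of binomial coefficients, at most `(|S| / N) ^ r` with `N` the number of cells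
(`measureReal_cellsMeeting_subset`).

For a clopen `U ≠ X`, the density axiom bounds the proportion of cells inside `U` by some `θ < 1`,
so large `r` contribute little to the probability of `K ⊆ U`, uniformly in `n`. For fixed `r`, the
probability of meeting `r` cells tends to that of `K` having `r` points. Hence the law of the
cardinality determines the probability of `K ⊆ U`; these events form a π-system generating the Borel
sets, so it determines `ν` (`eq_of_encard_law_eq`).

It remains to realise the possible laws. `δ_X` gives infinite cardinality, and `muK μ k` gives
exactly `k` because `μ × μ` does not charge the diagonal. So `ν` is the mixture weighted by its own
cardinality law. If `K` has `k ≥ 1` points with positive probability, averaging the counting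
measures of such `K` yields an invariant measure on `X`; without one, only `δ_X` is left. -/

namespace IRC

/-! ### Cells met by a set, and its cardinality -/

section Cells

variable {X : Type*} [MetricSpace X]

open Classical in
/-- The cells of the `n`-th partition which meet the set `S`. -/
noncomputable def cellsMeeting (T : TreeStructure X) (n : ℕ) (S : Set X) : Finset (Set X) :=
  (T.cells n).filter fun D => (D ∩ S).Nonempty

variable {T : TreeStructure X} {n : ℕ} {S : Set X} {C D : Set X}

theorem mem_cellsMeeting : D ∈ cellsMeeting T n S ↔ D ∈ T.cells n ∧ (D ∩ S).Nonempty := by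
  simp [cellsMeeting]

theorem cellsMeeting_subset : cellsMeeting T n S ⊆ T.cells n := by
  classical
  exact Finset.filter_subset _ _

theorem exists_mem_cells (T : TreeStructure X) (n : ℕ) (x : X) : ∃ C ∈ T.cells n, x ∈ C := by
  have h : x ∈ ⋃₀ (T.cells n : Set (Set X)) := by rw [T.sUnion_eq]; trivial
  simpa using h

theorem cells_eq_of_mem {x : X} (hC : C ∈ T.cells n) (hD : D ∈ T.cells n) (hxC : x ∈ C)
    (hxD : x ∈ D) : C = D := by
  by_contra hne
  exact (disjoint_left.1 (T.pairwiseDisjoint n hC hD hne)) hxC hxD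

theorem eventually_ediam_lt (T : TreeStructure X) {ε : ℝ≥0∞} (hε : 0 < ε) :
    ∀ᶠ n in atTop, ∀ C ∈ T.cells n, Metric.ediam C < ε := by
  filter_upwards [T.tendsto_diam.eventually_lt_const hε] with n hn C hC
  exact (Finset.le_sup (f := Metric.ediam) hC).trans_lt hn

/-- A clopen set is eventually a union of cells. -/
theorem eventually_subset_or_disjoint [CompactSpace X] (T : TreeStructure X) {U : Set X}
    (hU : IsClopen U) : ∀ᶠ n in atTop, ∀ C ∈ T.cells n, C ⊆ U ∨ Disjoint C U := by
  -- A Lebesgue number of the cover by `U` and its complement: smaller cells lie in one of the two.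
  obtain ⟨δ, hδ, h⟩ := lebesgue_number_lemma_of_metric (c := fun b : Bool => if b then U else Uᶜ)
    (isCompact_univ (X := X))
    (by rintro (_ | _); exacts [by simpa using hU.compl.isOpen, by simpa using hU.isOpen])
    (fun x _ => by by_cases hx : x ∈ U <;> simp [hx])
  filter_upwards [eventually_ediam_lt T (ENNReal.ofReal_pos.2 hδ)] with n hn C hC
  obtain ⟨x, hx⟩ := T.nonempty n C hC
  have hCb : C ⊆ Metric.ball x δ := fun y hy => by
    rw [Metric.mem_ball, ← edist_lt_ofReal]
    exact (Metric.edist_le_ediam_of_mem hy hx).trans_lt (hn C hC)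
  obtain ⟨b, hb⟩ := h x trivial
  cases b with
  | true => exact Or.inl (hCb.trans (by simpa using hb))
  | false => exact Or.inr (subset_compl_iff_disjoint_right.1 (hCb.trans (by simpa using hb)))

theorem card_cellsMeeting_le_encard (T : TreeStructure X) (n : ℕ) (S : Set X) :
    ((cellsMeeting T n S).card : ℕ∞) ≤ S.encard := by
  obtain hX | hX := isEmpty_or_nonempty X
  · have : cellsMeeting T n S = ∅ := Finset.eq_empty_of_forall_notMem fun D hD =>
      isEmptyElim (mem_cellsMeeting.1 hD).2.some
    simp [this]
  choose! f hf using fun D (hD : D ∈ cellsMeeting T n S) => (mem_cellsMeeting.1 hD).2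
  rw [← encard_coe_eq_coe_finsetCard]
  refine encard_le_encard_of_injOn (f := f) (fun D hD => (hf D hD).2) fun D hD E hE h => ?_
  exact cells_eq_of_mem (mem_cellsMeeting.1 hD).1 (mem_cellsMeeting.1 hE).1 (hf D hD).1
    (h ▸ (hf E hE).1)

/-- Any `k` points of `S` lie in distinct cells once the diameters drop below their mutual
distances. -/
theorem eventually_le_card_cellsMeeting (T : TreeStructure X) {k : ℕ} (h : (k : ℕ∞) ≤ S.encard) :
    ∀ᶠ n in atTop, k ≤ (cellsMeeting T n S).card := by
  obtain ⟨F, hFS, hF⟩ := exists_subset_encard_eq h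
  lift F to Finset X using finite_of_encard_eq_coe hF
  have hk : F.card = k := by simpa [encard_coe_eq_coe_finsetCard] using hF
  have hev : ∀ᶠ n in atTop, ∀ x ∈ F, ∀ y ∈ F, x ≠ y → ∀ C ∈ T.cells n, x ∈ C → y ∉ C := by
    refine (Filter.eventually_all_finset F).2 fun x _ =>
      (Filter.eventually_all_finset F).2 fun y _ => ?_
    by_cases hxy : x = y
    · simp [hxy]
    · filter_upwards [eventually_ediam_lt T (edist_pos.2 hxy)] with n hn _ C hC hx hy
      exact (Metric.edist_le_ediam_of_mem hx hy).not_gt (hn C hC)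
  filter_upwards [hev] with n hn
  choose f hf using exists_mem_cells T n
  rw [← hk]
  refine Finset.card_le_card_of_injOn f (fun x hx => mem_cellsMeeting.2
    ⟨(hf x).1, x, (hf x).2, hFS hx⟩) fun x hx y hy h => ?_
  by_contra hne
  exact hn x hx y hy hne (f x) (hf x).1 (hf x).2 (h ▸ (hf y).2)

theorem encard_eq_iSup_card_cellsMeeting (T : TreeStructure X) (S : Set X) :
    S.encard = ⨆ n, ((cellsMeeting T n S).card : ℕ∞) := by
  refine le_antisymm (ENat.forall_natCast_le_iff_le.1 fun k hk => ?_)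
    (iSup_le fun n => card_cellsMeeting_le_encard T n S)
  obtain ⟨n, hn⟩ := (eventually_le_card_cellsMeeting T hk).exists
  exact (Nat.cast_le.2 hn).trans (le_iSup (fun n => ((cellsMeeting T n S).card : ℕ∞)) n)

/-- If `S` has more than `r` points, the count eventually exceeds `r`; otherwise it eventually
equals the cardinality of `S`. -/
theorem eventually_card_cellsMeeting_eq_iff (T : TreeStructure X) (S : Set X) (r : ℕ) :
    ∀ᶠ n in atTop, ((cellsMeeting T n S).card = r ↔ S.encard = r) := by
  by_cases h : ((r + 1 : ℕ) : ℕ∞) ≤ S.encard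
  · filter_upwards [eventually_le_card_cellsMeeting T h] with n hn
    refine ⟨fun h' => by omega, fun h' => ?_⟩
    rw [h', Nat.cast_le] at h
    omega
  · have hlt : S.encard < ⊤ := (not_le.1 h).trans (ENat.natCast_lt_top _)
    obtain ⟨s, hs⟩ := ENat.ne_top_iff_exists.1 hlt.ne
    filter_upwards [eventually_le_card_cellsMeeting T hs.le] with n hn
    have := card_cellsMeeting_le_encard T n S
    rw [← hs, Nat.cast_le] at this
    rw [← hs, Nat.cast_inj]
    omega

theorem cellsMeeting_univ (T : TreeStructure X) (n : ℕ) : cellsMeeting T n univ = T.cells n := by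
  ext D
  rw [mem_cellsMeeting, inter_univ]
  exact ⟨fun h => h.1, fun h => ⟨h, T.nonempty n D h⟩⟩

theorem tendsto_card_cells [Infinite X] (T : TreeStructure X) :
    Tendsto (fun n => (T.cells n).card) atTop atTop := by
  refine tendsto_atTop.2 fun k => ?_
  simpa only [cellsMeeting_univ] using
    eventually_le_card_cellsMeeting (S := univ) (k := k) T (by simp)

end Cells

/-! ### The Borel structure of the space of compact sets -/

section Measurability

variable {X : Type*}

/-- The compact sets contained in `U`. -/
def compactsWithin [TopologicalSpace X] (U : Set X) : Set (NonemptyCompacts X) :=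
  {K | (K : Set X) ⊆ U}

theorem measurableSet_compactsWithin [TopologicalSpace X] {U : Set X} (hU : IsClopen U) :
    MeasurableSet (compactsWithin U) :=
  (NonemptyCompacts.isOpen_subsets_of_isOpen hU.isOpen).measurableSet

theorem measurableSet_inter_nonempty [TopologicalSpace X] {U : Set X} (hU : IsClopen U) :
    MeasurableSet {K : NonemptyCompacts X | ((K : Set X) ∩ U).Nonempty} :=
  (NonemptyCompacts.isOpen_inter_nonempty_of_isOpen hU.isOpen).measurableSet

theorem isPiSystem_compactsWithin [TopologicalSpace X] :
    IsPiSystem {E : Set (NonemptyCompacts X) | ∃ U, IsClopen U ∧ compactsWithin U = E} := by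
  rintro _ ⟨U, hU, rfl⟩ _ ⟨V, hV, rfl⟩ -
  refine ⟨U ∩ V, hU.inter hV, ?_⟩
  ext K
  exact subset_inter_iff

/-- Clopen sets form a basis of `X`, so the Vietoris topology has a basis of sets defined by
finitely many clopen sets. Meeting `U` is the negation of being contained in its complement. -/
theorem borel_nonemptyCompacts_eq_generateFrom [MetricSpace X] [CompactSpace X]
    [TotallyDisconnectedSpace X] :
    borelNonemptyCompacts X = MeasurableSpace.generateFrom
      {E : Set (NonemptyCompacts X) | ∃ U, IsClopen U ∧ compactsWithin U = E} := by
  have hB := (isTopologicalBasis_isClopen (X := X)).nonemptyCompacts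
  refine le_antisymm ?_ (MeasurableSpace.generateFrom_le ?_)
  · refine (hB.borel_eq_generateFrom).trans_le (MeasurableSpace.generateFrom_le ?_)
    rintro _ ⟨u, ⟨hu, -, huc⟩, rfl⟩
    have h1 : IsClopen (⋃₀ u) := by
      rw [sUnion_eq_biUnion]
      exact hu.isClopen_biUnion fun U hU => huc hU
    have : {K : NonemptyCompacts X | (K : Set X) ⊆ ⋃₀ u ∧ ∀ U ∈ u, ((K : Set X) ∩ U).Nonempty} =
        compactsWithin (⋃₀ u) ∩ ⋂ U ∈ u, (compactsWithin Uᶜ)ᶜ := by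
      ext K
      simp only [compactsWithin, mem_inter_iff, mem_iInter, mem_compl_iff, mem_ofPred_eq,
        subset_compl_iff_disjoint_right, not_disjoint_iff_nonempty_inter]
    beta_reduce
    rw [this]
    refine MeasurableSet.inter (MeasurableSpace.measurableSet_generateFrom ⟨_, h1, rfl⟩) ?_
    refine MeasurableSet.biInter hu.countable fun U hU => MeasurableSet.compl ?_
    exact MeasurableSpace.measurableSet_generateFrom ⟨_, IsClopen.compl (huc hU), rfl⟩
  · rintro _ ⟨U, hU, rfl⟩
    exact measurableSet_compactsWithin hU

theorem measurable_of_preimage_compactsWithin [MetricSpace X] [CompactSpace X]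
    [TotallyDisconnectedSpace X] {Ω : Type*} [MeasurableSpace Ω] {f : Ω → NonemptyCompacts X}
    (h : ∀ U, IsClopen U → MeasurableSet (f ⁻¹' compactsWithin U)) : Measurable f := by
  have := borel_nonemptyCompacts_eq_generateFrom (X := X)
  rw [this]
  refine measurable_generateFrom ?_
  rintro _ ⟨U, hU, rfl⟩
  exact h U hU

theorem coe_smul_nonemptyCompacts {G : Type*} [Group G] [TopologicalSpace X] [MulAction G X]
    [ContinuousConstSMul G X] (g : G) (K : NonemptyCompacts X) :
    ((g • K : NonemptyCompacts X) : Set X) = (fun x => g • x) '' (K : Set X) := rfl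

theorem measurable_smul_nonemptyCompacts {G : Type*} [Group G] [TopologicalSpace X] [MulAction G X]
    [ContinuousConstSMul G X] (g : G) : Measurable fun K : NonemptyCompacts X => g • K :=
  (Continuous.nonemptyCompacts_map (continuous_const_smul g)).measurable

section Tree

variable [MetricSpace X]

/-- The map takes finitely many values, and each fibre is a finite Boolean combination of events
that `K` meets a clopen set. -/
theorem measurable_cellsMeeting_inter (T : TreeStructure X) (n : ℕ) {U : Set X} (hU : IsClopen U) :
    Measurable[_, ⊤] fun K : NonemptyCompacts X => cellsMeeting T n ((K : Set X) ∩ U) := by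
  have hcount : (range fun K : NonemptyCompacts X => cellsMeeting T n ((K : Set X) ∩ U)).Finite :=
    (T.cells n).powerset.finite_toSet.subset <| by
      rintro _ ⟨K, rfl⟩
      simpa using cellsMeeting_subset
  have hfib (A : Finset (Set X)) :
      MeasurableSet {K : NonemptyCompacts X | cellsMeeting T n ((K : Set X) ∩ U) = A} := by
    have : {K : NonemptyCompacts X | cellsMeeting T n ((K : Set X) ∩ U) = A} =
        ({K | A ⊆ T.cells n} ∩ ⋂ D ∈ T.cells n,
          {K : NonemptyCompacts X | ((K : Set X) ∩ (U ∩ D)).Nonempty ↔ D ∈ A}) := by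
      ext K
      simp only [mem_inter_iff, mem_iInter, mem_ofPred_eq, Finset.ext_iff, mem_cellsMeeting]
      constructor
      · intro h
        refine ⟨fun D hD => ((h D).2 hD).1, fun D hD => ?_⟩
        rw [← h D, ← inter_assoc, inter_comm _ D]
        simp [hD]
      · rintro ⟨h1, h2⟩ D
        refine ⟨fun h => (h2 D h.1).1 ?_, fun h => ⟨h1 h, ?_⟩⟩
        · rw [← inter_assoc, inter_comm _ D]; exact h.2
        · have := (h2 D (h1 h)).2 h
          rwa [← inter_assoc, inter_comm _ D] at this
    rw [this]
    refine MeasurableSet.inter (MeasurableSet.const _) ?_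
    refine Finset.measurableSet_biInter _ fun D hD => ?_
    have := measurableSet_inter_nonempty (hU.inter (T.isClopen n D hD))
    by_cases hDA : D ∈ A
    · simpa [hDA] using this
    · convert this.compl using 1
      ext K
      simp [hDA]
  intro s _
  have : (fun K : NonemptyCompacts X => cellsMeeting T n ((K : Set X) ∩ U)) ⁻¹' s =
      ⋃ A ∈ (range fun K : NonemptyCompacts X => cellsMeeting T n ((K : Set X) ∩ U)) ∩ s,
        {K : NonemptyCompacts X | cellsMeeting T n ((K : Set X) ∩ U) = A} := by
    ext K
    simp
  rw [this]
  exact (hcount.inter_of_left s).measurableSet_biUnion fun A _ => hfib A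

theorem measurable_encard_inter (T : TreeStructure X) {U : Set X} (hU : IsClopen U) :
    Measurable fun K : NonemptyCompacts X => ((K : Set X) ∩ U).encard := by
  have : BorelSpace ℕ∞ := ⟨borel_eq_top_of_countable.symm⟩
  simp_rw [encard_eq_iSup_card_cellsMeeting T]
  refine Measurable.iSup fun n => ?_
  exact (measurable_from_top (f := fun A : Finset (Set X) => (A.card : ℕ∞))).comp
    (measurable_cellsMeeting_inter T n hU)

theorem measurable_cellsMeeting (T : TreeStructure X) (n : ℕ) :
    Measurable[_, ⊤] fun K : NonemptyCompacts X => cellsMeeting T n (K : Set X) := by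
  simpa using measurable_cellsMeeting_inter T n isClopen_univ

theorem measurable_encard (T : TreeStructure X) :
    Measurable fun K : NonemptyCompacts X => (K : Set X).encard := by
  simpa using measurable_encard_inter T isClopen_univ

theorem measurableSet_encard_eq (T : TreeStructure X) (r : ℕ∞) :
    MeasurableSet {K : NonemptyCompacts X | (K : Set X).encard = r} :=
  measurable_encard T (measurableSet_singleton r)

end Tree

end Measurability

/-! ### A bound on ratios of binomial coefficients -/

section Counting

/-- Compare factor by factor: `(a - i) / (N - i) ≤ a / N`, with denominators cleared. -/
theorem choose_mul_pow_le {a N : ℕ} (h : a ≤ N) (r : ℕ) :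
    a.choose r * N ^ r ≤ N.choose r * a ^ r := by
  have key : a.descFactorial r * N ^ r ≤ N.descFactorial r * a ^ r := by
    induction r with
    | zero => simp
    | succ r ih =>
      have h1 : (a - r) * N ≤ (N - r) * a := by
        rw [Nat.sub_mul, Nat.sub_mul, mul_comm N a]
        exact Nat.sub_le_sub_left (Nat.mul_le_mul_left r h) _
      calc a.descFactorial (r + 1) * N ^ (r + 1)
          = ((a - r) * N) * (a.descFactorial r * N ^ r) := by
            rw [Nat.descFactorial_succ, pow_succ]; ring
        _ ≤ ((N - r) * a) * (N.descFactorial r * a ^ r) := Nat.mul_le_mul h1 ih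
        _ = N.descFactorial (r + 1) * a ^ (r + 1) := by
            rw [Nat.descFactorial_succ, pow_succ]; ring
  rw [Nat.descFactorial_eq_factorial_mul_choose, Nat.descFactorial_eq_factorial_mul_choose,
    mul_assoc, mul_assoc] at key
  exact Nat.le_of_mul_le_mul_left key r.factorial_pos

theorem choose_div_choose_le {a N : ℕ} (h : a ≤ N) (r : ℕ) :
    (a.choose r : ℝ) / N.choose r ≤ ((a : ℝ) / N) ^ r := by
  rcases Nat.eq_zero_or_pos (N.choose r) with h0 | h0
  · rw [h0, Nat.cast_zero, div_zero]; positivity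
  rcases Nat.eq_zero_or_pos N with rfl | hN
  · obtain rfl : a = 0 := by omega
    rcases r with _ | r <;> simp
  rw [div_pow, div_le_div_iff₀ (by exact_mod_cast h0) (by positivity), mul_comm _ (N.choose r : ℝ)]
  exact_mod_cast choose_mul_pow_le h r

end Counting

/-! ### The cardinality law determines an invariant random compact -/

section Uniqueness

variable {G X : Type*} [Group G] [MetricSpace X] [MulAction G X] [ContinuousConstSMul G X]
  {T : TreeStructure X} {n : ℕ} {ν ν' : Measure (NonemptyCompacts X)}

/-- Since `K` lies in the union of the cells of `A`, it does not matter whether `g` maps other cells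
to cells. -/
theorem cellsMeeting_smul {g : G} {A B : Finset (Set X)} (hB : B ⊆ T.cells n)
    (hg : (fun C : Set X => (fun x => g • x) '' C) '' (A : Set (Set X)) = (B : Set (Set X)))
    {K : NonemptyCompacts X} (hK : cellsMeeting T n (K : Set X) = A) :
    cellsMeeting T n ((g • K : NonemptyCompacts X) : Set X) = B := by
  have hmem : ∀ C ∈ A, (fun x => g • x) '' C ∈ B := fun C hC => by
    rw [← Finset.mem_coe, ← hg]
    exact mem_image_of_mem _ hC
  ext D
  rw [mem_cellsMeeting, coe_smul_nonemptyCompacts]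
  constructor
  · rintro ⟨hD, x, hxD, y, hy, rfl⟩
    obtain ⟨C, hC, hyC⟩ := exists_mem_cells T n y
    have hCA : C ∈ A := hK ▸ mem_cellsMeeting.2 ⟨hC, y, hyC, hy⟩
    have := hmem C hCA
    rwa [cells_eq_of_mem (hB this) hD (mem_image_of_mem _ hyC) hxD] at this
  · intro hD
    refine ⟨hB hD, ?_⟩
    rw [← Finset.mem_coe, ← hg] at hD
    obtain ⟨C, hC, rfl⟩ := hD
    rw [Finset.mem_coe, ← hK] at hC
    obtain ⟨-, y, hyC, hyK⟩ := mem_cellsMeeting.1 hC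
    exact ⟨g • y, mem_image_of_mem _ hyC, mem_image_of_mem _ hyK⟩

theorem measure_cellsMeeting_eq (hT : DeeplyTransitiveWith G T)
    [SMulInvariantMeasure G (NonemptyCompacts X) ν] {A B : Finset (Set X)}
    (hA : A ⊆ T.cells n) (hB : B ⊆ T.cells n) (h : A.card = B.card) :
    ν {K | cellsMeeting T n (K : Set X) = A} = ν {K | cellsMeeting T n (K : Set X) = B} := by
  obtain ⟨g, hg⟩ := hT n A B hA hB h
  have hg' : (fun C : Set X => (fun x => g⁻¹ • x) '' C) '' (B : Set (Set X)) = A := by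
    rw [← hg, image_image]
    simp [image_image]
  have hmeas : MeasurableSet {K : NonemptyCompacts X | cellsMeeting T n (K : Set X) = B} :=
    measurable_cellsMeeting T n (t := {B}) trivial
  rw [← SMulInvariantMeasure.measure_preimage_smul (μ := ν) g hmeas]
  congr 1
  ext K
  refine ⟨fun hK => cellsMeeting_smul hB hg hK, fun hK => ?_⟩
  simpa using cellsMeeting_smul hA hg' hK

/-- All `r`-element sets of cells are equally likely, so both sides reduce to counting `r`-subsets.
-/
theorem measureReal_cellsMeeting_subset (hT : DeeplyTransitiveWith G T) [IsFiniteMeasure ν]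
    [SMulInvariantMeasure G (NonemptyCompacts X) ν] {S : Finset (Set X)} (hS : S ⊆ T.cells n)
    (r : ℕ) :
    ν.real {K | cellsMeeting T n (K : Set X) ⊆ S ∧ (cellsMeeting T n (K : Set X)).card = r} =
      (S.card.choose r : ℝ) / (T.cells n).card.choose r *
        ν.real {K | (cellsMeeting T n (K : Set X)).card = r} := by
  obtain ⟨p, hp⟩ : ∃ p : ℝ, ∀ B ⊆ T.cells n, B.card = r →
      ν.real {K | cellsMeeting T n (K : Set X) = B} = p := by
    by_cases h : ∃ A ⊆ T.cells n, A.card = r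
    · obtain ⟨A, hA, rfl⟩ := h
      exact ⟨_, fun B hB hBA => congrArg ENNReal.toReal (measure_cellsMeeting_eq hT hB hA hBA)⟩
    · exact ⟨0, fun B hB hBr => absurd ⟨B, hB, hBr⟩ h⟩
  have key : ∀ S ⊆ T.cells n, ν.real {K | cellsMeeting T n (K : Set X) ⊆ S ∧
      (cellsMeeting T n (K : Set X)).card = r} = S.card.choose r * p := by
    intro S hS
    have hU : {K : NonemptyCompacts X | cellsMeeting T n (K : Set X) ⊆ S ∧
        (cellsMeeting T n (K : Set X)).card = r} =
        ⋃ B ∈ Finset.powersetCard r S,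
          {K : NonemptyCompacts X | cellsMeeting T n (K : Set X) = B} := by
      ext K
      simp [Finset.mem_powersetCard]
    rw [hU, measureReal_biUnion_finset, Finset.sum_congr rfl fun B hB => hp B
      ((Finset.mem_powersetCard.1 hB).1.trans hS) (Finset.mem_powersetCard.1 hB).2,
      Finset.sum_const, Finset.card_powersetCard, nsmul_eq_mul]
    · refine fun A _ B _ hAB => disjoint_left.2 fun K hKA hKB => hAB ?_
      exact Eq.trans (Eq.symm hKA) hKB
    · exact fun B _ => measurable_cellsMeeting T n (t := {B}) trivial
  have hN := key (T.cells n) subset_rfl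
  simp only [cellsMeeting_subset, true_and] at hN
  rw [key S hS, hN]
  -- When `r` exceeds the number of cells, the quotient has a zero denominator and both sides
  -- vanish.
  rcases Nat.eq_zero_or_pos ((T.cells n).card.choose r) with h0 | h0
  · have : S.card.choose r = 0 :=
      Nat.eq_zero_of_le_zero ((Nat.choose_le_choose r (Finset.card_le_card hS)).trans h0.le)
    simp [h0, this]
  · have : ((T.cells n).card.choose r : ℝ) ≠ 0 := by exact_mod_cast h0.ne'
    field_simp

theorem sum_measureReal_card_cellsMeeting [IsFiniteMeasure ν] {E : Set (NonemptyCompacts X)}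
    (hE : MeasurableSet E) :
    ∑ r ∈ Finset.range ((T.cells n).card + 1),
      ν.real {K | K ∈ E ∧ (cellsMeeting T n (K : Set X)).card = r} = ν.real E := by
  rw [← measureReal_biUnion_finset]
  · congr 1
    ext K
    have := Finset.card_le_card (cellsMeeting_subset (T := T) (n := n) (S := K))
    simp only [mem_iUnion, mem_ofPred_eq, Finset.mem_range, exists_prop]
    exact ⟨fun ⟨_, _, h, _⟩ => h, fun h => ⟨_, by omega, h, rfl⟩⟩
  · refine fun r _ s _ hrs => disjoint_left.2 fun K hr hs => hrs ?_
    exact hr.2.symm.trans hs.2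
  · exact fun r _ => hE.inter (measurable_cellsMeeting T n (t := {A | A.card = r}) trivial)

/-- Two invariant random compacts meet only cells of `S` with nearly equal probabilities, if the
numbers of cells which they meet have nearly equal laws. -/
theorem abs_measureReal_sub_le (hT : DeeplyTransitiveWith G T)
    [IsProbabilityMeasure ν] [SMulInvariantMeasure G (NonemptyCompacts X) ν]
    [IsProbabilityMeasure ν'] [SMulInvariantMeasure G (NonemptyCompacts X) ν']
    {S : Finset (Set X)} (hS : S ⊆ T.cells n) (R : ℕ) :
    |ν.real {K | cellsMeeting T n (K : Set X) ⊆ S} -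
        ν'.real {K | cellsMeeting T n (K : Set X) ⊆ S}| ≤
      ∑ r ∈ Finset.range R, |ν.real {K | (cellsMeeting T n (K : Set X)).card = r} -
        ν'.real {K | (cellsMeeting T n (K : Set X)).card = r}| +
      2 * ((S.card : ℝ) / (T.cells n).card) ^ R := by
  have hE : MeasurableSet {K : NonemptyCompacts X | cellsMeeting T n (K : Set X) ⊆ S} :=
    measurable_cellsMeeting T n (t := {A | A ⊆ S}) trivial
  have hle := Finset.card_le_card hS
  set N := (T.cells n).card
  set f := fun r : ℕ => ν.real {K | (cellsMeeting T n (K : Set X)).card = r}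
  set g := fun r : ℕ => ν'.real {K | (cellsMeeting T n (K : Set X)).card = r}
  set q := fun r : ℕ => (S.card.choose r : ℝ) / N.choose r
  set θ := (S.card : ℝ) / N
  have hθ0 : 0 ≤ θ := by positivity
  have hθ1 : θ ≤ 1 := div_le_one_of_le₀ (by exact_mod_cast hle) (by positivity)
  have hf : ∑ r ∈ Finset.range (N + 1), f r = 1 := by
    simpa using sum_measureReal_card_cellsMeeting (T := T) (n := n) (ν := ν) MeasurableSet.univ
  have hg : ∑ r ∈ Finset.range (N + 1), g r = 1 := by
    simpa using sum_measureReal_card_cellsMeeting (T := T) (n := n) (ν := ν') MeasurableSet.univ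
  have hf0 (r) : 0 ≤ f r := measureReal_nonneg
  have hg0 (r) : 0 ≤ g r := measureReal_nonneg
  have hq0 (r) : 0 ≤ q r := by positivity
  have hq (r) : q r ≤ θ ^ r := choose_div_choose_le hle r
  rw [← sum_measureReal_card_cellsMeeting (T := T) (n := n) hE,
    ← sum_measureReal_card_cellsMeeting (T := T) (n := n) hE, ← Finset.sum_sub_distrib]
  simp only [mem_ofPred_eq, measureReal_cellsMeeting_subset hT hS, ← mul_sub]
  calc |∑ r ∈ Finset.range (N + 1), q r * (f r - g r)|
      ≤ ∑ r ∈ Finset.range (N + 1), |q r * (f r - g r)| := Finset.abs_sum_le_sum_abs _ _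
    -- Split at `R`: below it `q r ≤ 1`, from it on `q r ≤ θ ^ R`. As `f` and `g` each sum to `1`,
    -- the tail costs at most `2 * θ ^ R`.
    _ ≤ ∑ r ∈ Finset.range (N + 1),
          ((if r < R then |f r - g r| else 0) + θ ^ R * (f r + g r)) := by
        refine Finset.sum_le_sum fun r _ => ?_
        rw [abs_mul, abs_of_nonneg (hq0 r)]
        split_ifs with hr
        · have h1 : q r ≤ 1 := (hq r).trans (pow_le_one₀ hθ0 hθ1)
          have h2 : 0 ≤ θ ^ R * (f r + g r) :=
            mul_nonneg (pow_nonneg hθ0 R) (add_nonneg (hf0 r) (hg0 r))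
          have h3 := mul_le_mul_of_nonneg_right h1 (abs_nonneg (f r - g r))
          linarith
        · rw [zero_add]
          refine mul_le_mul ((hq r).trans (pow_le_pow_of_le_one hθ0 hθ1 (not_lt.1 hr))) ?_
            (abs_nonneg _) (pow_nonneg hθ0 R)
          rw [abs_le]
          constructor <;> linarith [hf0 r, hg0 r]
    _ ≤ _ := by
        rw [Finset.sum_add_distrib, ← Finset.mul_sum, Finset.sum_add_distrib, hf, hg,
          ← Finset.sum_filter]
        have : ∑ r ∈ Finset.range (N + 1) with r < R, |f r - g r| ≤
            ∑ r ∈ Finset.range R, |f r - g r| :=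
          Finset.sum_le_sum_of_subset_of_nonneg
            (fun r hr => Finset.mem_range.2 (Finset.mem_filter.1 hr).2)
            fun _ _ _ => abs_nonneg _
        linarith

/-- The indicators converge pointwise, being eventually constant in `n` for each `K`, and `ν` is
finite. -/
theorem tendsto_measureReal_card_cellsMeeting (T : TreeStructure X) [IsFiniteMeasure ν] (r : ℕ) :
    Tendsto (fun n => ν.real {K | (cellsMeeting T n (K : Set X)).card = r}) atTop
      (𝓝 (ν.real {K | (K : Set X).encard = r})) := by
  refine (ENNReal.tendsto_toReal (measure_ne_top _ _)).comp ?_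
  refine tendsto_measure_of_ae_tendsto_indicator_of_isFiniteMeasure atTop
    (measurableSet_encard_eq T r)
    (fun n => measurable_cellsMeeting T n (t := {A | A.card = r}) trivial) ?_
  exact Eventually.of_forall fun K => eventually_card_cellsMeeting_eq_iff T K r

/-- The cells outside a nonempty clopen set have density bounded away from `1`. -/
theorem exists_density_le [CompactSpace X] (T : TreeStructure X) {U : Set X} (hU : IsClopen U)
    (hne : U ≠ univ) : ∃ θ : ℝ, 0 ≤ θ ∧ θ < 1 ∧ ∀ᶠ n in atTop, ∀ S ⊆ T.cells n,
      (∀ D ∈ S, D ⊆ U) → (S.card : ℝ) / (T.cells n).card ≤ θ := by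
  classical
  obtain ⟨x, hx⟩ := (ne_univ_iff_exists_notMem U).1 hne
  obtain ⟨k, hk⟩ := (eventually_subset_or_disjoint T hU).exists
  obtain ⟨C, hC, hxC⟩ := exists_mem_cells T k x
  have hCU : Disjoint C U := (hk C hC).resolve_left fun h => hx (h hxC)
  set δ := ⨅ n : Ici k, (({D | D ∈ T.cells n ∧ D ⊆ C}.ncard : ℝ) / ((T.cells n).card : ℝ))
  have hδ : 0 < δ := T.density_pos k C hC
  -- Cells inside `C` make up at least a fraction `δ` of level `n`, and none belongs to `S`. The
  -- maximum only secures nonnegativity.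
  refine ⟨max (1 - δ) 0, le_max_right _ _, max_lt (by linarith) one_pos, ?_⟩
  filter_upwards [eventually_ge_atTop k] with n hn S hS hSU
  have hδn : δ ≤ ({D | D ∈ T.cells n ∧ D ⊆ C}.ncard : ℝ) / ((T.cells n).card : ℝ) :=
    ciInf_le (f := fun n : Ici k => ({D | D ∈ T.cells n ∧ D ⊆ C}.ncard : ℝ) /
      ((T.cells n).card : ℝ)) ⟨0, by rintro _ ⟨m, rfl⟩; positivity⟩ ⟨n, hn⟩
  have hcoe : {D | D ∈ T.cells n ∧ D ⊆ C} = ((T.cells n).filter (· ⊆ C) : Finset (Set X)) := by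
    ext D
    simp
  rw [hcoe, ncard_coe_finset] at hδn
  refine le_max_of_le_left ?_
  have hdisj : Disjoint S ((T.cells n).filter (· ⊆ C)) := Finset.disjoint_left.2 fun D hD hD' => by
    obtain ⟨y, hy⟩ := T.nonempty n D (hS hD)
    exact disjoint_left.1 hCU ((Finset.mem_filter.1 hD').2 hy) (hSU D hD hy)
  have hcard : S.card + ((T.cells n).filter (· ⊆ C)).card ≤ (T.cells n).card := by
    rw [← Finset.card_union_of_disjoint hdisj]
    exact Finset.card_le_card (Finset.union_subset hS (Finset.filter_subset _ _))
  obtain ⟨D, hD, -⟩ := exists_mem_cells T n x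
  have hN : (0 : ℝ) < (T.cells n).card := by exact_mod_cast Finset.card_pos.2 ⟨D, hD⟩
  rw [le_div_iff₀ hN] at hδn
  rw [div_le_iff₀ hN]
  have : (S.card : ℝ) + ((T.cells n).filter (· ⊆ C)).card ≤ (T.cells n).card := by
    exact_mod_cast hcard
  linarith

/-- Order of limits: with `R` fixed, `n → ∞` kills the finite sum in `abs_measureReal_sub_le`; then
`R → ∞` kills `2 * θ ^ R`. -/
theorem measureReal_compactsWithin_eq [CompactSpace X] (hT : DeeplyTransitiveWith G T)
    [IsProbabilityMeasure ν] [SMulInvariantMeasure G (NonemptyCompacts X) ν]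
    [IsProbabilityMeasure ν'] [SMulInvariantMeasure G (NonemptyCompacts X) ν']
    (h : ∀ r : ℕ, ν {K | (K : Set X).encard = r} = ν' {K | (K : Set X).encard = r})
    {U : Set X} (hU : IsClopen U) (hne : U ≠ univ) :
    ν.real (compactsWithin U) = ν'.real (compactsWithin U) := by
  classical
  obtain ⟨θ, hθ0, hθ1, hθ⟩ := exists_density_le T hU hne
  have hbound (R : ℕ) :
      |ν.real (compactsWithin U) - ν'.real (compactsWithin U)| ≤ 2 * θ ^ R := by
    have hlim : Tendsto (fun n => ∑ r ∈ Finset.range R,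
        |ν.real {K | (cellsMeeting T n (K : Set X)).card = r} -
          ν'.real {K | (cellsMeeting T n (K : Set X)).card = r}| + 2 * θ ^ R) atTop
        (𝓝 (∑ r ∈ Finset.range R, |(0 : ℝ)| + 2 * θ ^ R)) := by
      refine (tendsto_finsetSum _ fun r _ => ?_).add_const _
      have := (tendsto_measureReal_card_cellsMeeting (ν := ν) T r).sub
        (tendsto_measureReal_card_cellsMeeting (ν := ν') T r)
      simpa [Measure.real, h r] using this.abs
    simp only [abs_zero, Finset.sum_const_zero, zero_add] at hlim
    refine ge_of_tendsto hlim ?_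
    filter_upwards [hθ, eventually_subset_or_disjoint T hU] with n hn hadapt
    set S := (T.cells n).filter (· ⊆ U)
    have hSn : S ⊆ T.cells n := Finset.filter_subset _ _
    have hW : compactsWithin U = {K : NonemptyCompacts X | cellsMeeting T n (K : Set X) ⊆ S} := by
      ext K
      constructor
      · intro hK D hD
        obtain ⟨hD, x, hxD, hxK⟩ := mem_cellsMeeting.1 hD
        exact Finset.mem_filter.2 ⟨hD, (hadapt D hD).resolve_right fun hdisj =>
          disjoint_left.1 hdisj hxD (hK hxK)⟩
      · intro hK x hx
        obtain ⟨D, hD, hxD⟩ := exists_mem_cells T n x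
        exact (Finset.mem_filter.1 (hK (mem_cellsMeeting.2 ⟨hD, x, hxD, hx⟩))).2 hxD
    rw [hW]
    refine (abs_measureReal_sub_le hT hSn R).trans ?_
    gcongr
    exact hn S hSn fun D hD => (Finset.mem_filter.1 hD).2
  have hlim : Tendsto (fun R => 2 * θ ^ R) atTop (𝓝 (2 * 0)) :=
    (tendsto_pow_atTop_nhds_zero_of_lt_one hθ0 hθ1).const_mul 2
  have := ge_of_tendsto' hlim hbound
  rw [mul_zero] at this
  exact sub_eq_zero.1 (abs_nonpos_iff.1 this)

/-- An invariant random compact is determined by the law of its cardinality. -/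
theorem eq_of_encard_law_eq [CompactSpace X] [TotallyDisconnectedSpace X]
    (hT : DeeplyTransitiveWith G T)
    [IsProbabilityMeasure ν] [SMulInvariantMeasure G (NonemptyCompacts X) ν]
    [IsProbabilityMeasure ν'] [SMulInvariantMeasure G (NonemptyCompacts X) ν']
    (h : ∀ r : ℕ, ν {K | (K : Set X).encard = r} = ν' {K | (K : Set X).encard = r}) : ν = ν' := by
  refine ext_of_generate_finite _ borel_nonemptyCompacts_eq_generateFrom
    isPiSystem_compactsWithin ?_ (by simp)
  rintro _ ⟨U, hU, rfl⟩
  by_cases hne : U = univ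
  · subst hne
    have : compactsWithin (univ : Set X) = univ := by ext K; simp [compactsWithin]
    simp [this]
  · have := measureReal_compactsWithin_eq hT h hU hne
    rwa [measureReal_eq_measureReal_iff] at this

end Uniqueness

/-! ### Invariant measures on `X` and the measures `muK μ k` -/

section InvariantOnSpace

theorem smul_rho {G X : Type*} [Group G] [TopologicalSpace X] [MulAction G X]
    [ContinuousConstSMul G X] (g : G) (k : ℕ) [NeZero k] (x : Fin k → X) :
    g • rho X k x = rho X k fun i => g • x i := by
  apply NonemptyCompacts.ext
  rw [coe_smul_nonemptyCompacts]
  exact (range_comp (fun x => g • x) x).symm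

variable {G X : Type*} [Group G] [MetricSpace X] [MeasurableSpace X] [BorelSpace X]
  [MulAction G X] {T : TreeStructure X} {n : ℕ} {μ : Measure X}

/-- Transitivity on single cells makes all cells of a level equally likely. -/
theorem measure_cell_eq (hT : DeeplyTransitiveWith G T) [IsProbabilityMeasure μ]
    [SMulInvariantMeasure G X μ] {C : Set X} (hC : C ∈ T.cells n) :
    μ C = ((T.cells n).card : ℝ≥0∞)⁻¹ := by
  have heq : ∀ D ∈ T.cells n, μ D = μ C := fun D hD => by
    obtain ⟨g, hg⟩ := hT n {D} {C} (by simpa using hD) (by simpa using hC) (by simp)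
    have hDC : (fun x => g • x) '' D = C := by simpa using hg
    rw [← SMulInvariantMeasure.measure_preimage_smul (μ := μ) g
      (T.isClopen n C hC).isOpen.measurableSet, ← hDC,
      preimage_image_eq _ (MulAction.injective g)]
  have hsum : ∑ D ∈ T.cells n, μ D = 1 := by
    change ∑ D ∈ T.cells n, μ (id D) = 1
    rw [← measure_biUnion_finset (f := id) (T.pairwiseDisjoint n)
      fun D hD => (T.isClopen n D hD).isOpen.measurableSet, ← measure_univ (μ := μ),
      ← T.sUnion_eq n, sUnion_eq_biUnion]
    rfl
  rw [Finset.sum_congr rfl heq, Finset.sum_const, nsmul_eq_mul, mul_comm] at hsum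
  exact ENNReal.eq_inv_of_mul_eq_one_left hsum

/-- With `N` cells at a level, the diagonal is covered by `N` squares of measure `N⁻²` each, and `N
→ ∞`. -/
theorem pi_setOf_eq_eq_zero [CompactSpace X] [Infinite X] (hT : DeeplyTransitiveWith G T)
    [IsProbabilityMeasure μ] [SMulInvariantMeasure G X μ] {ι : Type*} [Fintype ι] {i j : ι}
    (hij : i ≠ j) : Measure.pi (fun _ : ι => μ) {x | x i = x j} = 0 := by
  classical
  have hle (n : ℕ) : Measure.pi (fun _ : ι => μ) {x | x i = x j} ≤
      ((T.cells n).card : ℝ≥0∞)⁻¹ := by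
    have hsub : {x : ι → X | x i = x j} ⊆ ⋃ C ∈ T.cells n,
        (univ.pi fun l => if l = i ∨ l = j then C else univ) := by
      intro x hx
      obtain ⟨C, hC, hxC⟩ := exists_mem_cells T n (x i)
      refine mem_biUnion hC fun l _ => ?_
      beta_reduce
      by_cases hl : l = i ∨ l = j
      · rw [if_pos hl]
        rcases hl with rfl | rfl
        · exact hxC
        · exact (show x i = x l from hx) ▸ hxC
      · rw [if_neg hl]; trivial
    have hprod (C : Set X) (hC : C ∈ T.cells n) : Measure.pi (fun _ : ι => μ)
        (univ.pi fun l => if l = i ∨ l = j then C else univ) =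
        ((T.cells n).card : ℝ≥0∞)⁻¹ * ((T.cells n).card : ℝ≥0∞)⁻¹ := by
      have h1 (l : ι) : μ (if l = i ∨ l = j then C else univ) =
          if l ∈ ({i, j} : Finset ι) then ((T.cells n).card : ℝ≥0∞)⁻¹ else 1 := by
        by_cases hl : l = i ∨ l = j <;> simp [hl, measure_cell_eq hT hC]
      rw [Measure.pi_pi, Finset.prod_congr rfl fun l _ => h1 l, Finset.prod_ite_mem,
        Finset.univ_inter, Finset.prod_pair hij]
    refine (measure_mono hsub).trans ((measure_biUnion_finset_le _ _).trans ?_)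
    rw [Finset.sum_congr rfl hprod, Finset.sum_const, nsmul_eq_mul, ← mul_assoc]
    exact mul_le_of_le_one_left' (ENNReal.mul_inv_le_one _)
  have hlim : Tendsto (fun n => ((T.cells n).card : ℝ≥0∞)⁻¹) atTop (𝓝 0) :=
    ENNReal.tendsto_inv_nat_nhds_zero.comp (tendsto_card_cells T)
  exact le_antisymm (ge_of_tendsto' hlim hle) zero_le

theorem ae_injective_pi [CompactSpace X] [Infinite X] (hT : DeeplyTransitiveWith G T)
    [IsProbabilityMeasure μ] [SMulInvariantMeasure G X μ] {ι : Type*} [Fintype ι] :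
    ∀ᵐ x ∂Measure.pi (fun _ : ι => μ), Function.Injective x := by
  have : ∀ᵐ x ∂Measure.pi (fun _ : ι => μ), ∀ i j, i ≠ j → x i ≠ x j := by
    refine ae_all_iff.2 fun i => ae_all_iff.2 fun j => ?_
    by_cases hij : i = j
    · simp [hij]
    · simpa [hij, ae_iff] using pi_setOf_eq_eq_zero hT hij
  filter_upwards [this] with x hx i j h
  exact not_imp_not.1 (hx i j) h

variable [CompactSpace X] [TotallyDisconnectedSpace X]

theorem measurable_rho (k : ℕ) [NeZero k] : Measurable (rho X k) := by
  refine measurable_of_preimage_compactsWithin fun U hU => ?_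
  have : rho X k ⁻¹' compactsWithin U = univ.pi fun _ => U := by
    ext x
    change range x ⊆ U ↔ _
    simp [range_subset_iff]
  rw [this]
  exact MeasurableSet.univ_pi fun _ => hU.isOpen.measurableSet

instance isProbabilityMeasure_muK [IsProbabilityMeasure μ] (k : ℕ) [NeZero k] :
    IsProbabilityMeasure (muK μ k) :=
  Measure.isProbabilityMeasure_map (measurable_rho k).aemeasurable

theorem muK_encard_eq [Infinite X] (hT : DeeplyTransitiveWith G T) [IsProbabilityMeasure μ]
    [SMulInvariantMeasure G X μ] (k : ℕ) [NeZero k] (r : ℕ) :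
    muK μ k {K | (K : Set X).encard = r} = if k = r then 1 else 0 := by
  have hae : ∀ᵐ x ∂Measure.pi (fun _ : Fin k => μ), ((rho X k x : Set X).encard = r) = (k = r) := by
    filter_upwards [ae_injective_pi hT] with x hx
    change ((range x).encard = r) = _
    rw [← image_univ, hx.encard_image, encard_univ]
    simp
  rw [muK, Measure.map_apply (measurable_rho k)
    (measurableSet_encard_eq T r)]
  refine (measure_congr (hae.mono fun x hx => hx)
    : _ = Measure.pi (fun _ : Fin k => μ) {_x | k = r}).trans ?_
  split_ifs with h <;> simp [h]

instance smulInvariantMeasure_muK [ContinuousConstSMul G X] [IsProbabilityMeasure μ]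
    [SMulInvariantMeasure G X μ] (k : ℕ) [NeZero k] :
    SMulInvariantMeasure G (NonemptyCompacts X) (muK μ k) where
  measure_preimage_smul g E hE := by
    have hpres : MeasurePreserving (fun (x : Fin k → X) i => g • x i)
        (Measure.pi fun _ => μ) (Measure.pi fun _ => μ) :=
      measurePreserving_pi _ _ fun _ => measurePreserving_smul g μ
    rw [muK, Measure.map_apply (measurable_rho k) (measurable_smul_nonemptyCompacts g hE),
      Measure.map_apply (measurable_rho k) hE,
      ← hpres.measure_preimage (measurable_rho k hE).nullMeasurableSet]
    congr 1
    ext x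
    simp [smul_rho]

end InvariantOnSpace

/-! ### The Dirac mass at `X` -/

section DiracWhole

variable {G X : Type*} [Group G] [MetricSpace X] [CompactSpace X] [Nonempty X]
  [MulAction G X] [ContinuousConstSMul G X]

instance isProbabilityMeasure_diracWhole : IsProbabilityMeasure (diracWhole X) :=
  inferInstanceAs (IsProbabilityMeasure (Measure.dirac _))

theorem smul_top_nonemptyCompacts (g : G) : g • (⊤ : NonemptyCompacts X) = ⊤ := by
  apply NonemptyCompacts.ext
  rw [coe_smul_nonemptyCompacts, NonemptyCompacts.coe_top, image_univ]
  exact (MulAction.surjective g).range_eq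

instance smulInvariantMeasure_diracWhole :
    SMulInvariantMeasure G (NonemptyCompacts X) (diracWhole X) where
  measure_preimage_smul g E hE := by
    rw [diracWhole, Measure.dirac_apply' _ hE,
      Measure.dirac_apply' _ (measurable_smul_nonemptyCompacts g hE)]
    have hiff : (⊤ : NonemptyCompacts X) ∈ (fun K => g • K) ⁻¹' E ↔ ⊤ ∈ E := by
      rw [mem_preimage, smul_top_nonemptyCompacts]
    by_cases h : (⊤ : NonemptyCompacts X) ∈ E
    · rw [indicator_of_mem h, indicator_of_mem (hiff.2 h)]
    · rw [indicator_of_notMem h, indicator_of_notMem (mt hiff.1 h)]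

theorem diracWhole_encard_eq [Infinite X] (T : TreeStructure X) (r : ℕ) :
    diracWhole X {K | (K : Set X).encard = r} = 0 := by
  rw [diracWhole, Measure.dirac_apply' _ (measurableSet_encard_eq T r)]
  simp

end DiracWhole

/-! ### From finite random compacts to invariant measures on `X` -/

section Empirical

variable {G X : Type*} [Group G] [MetricSpace X] [MeasurableSpace X] [BorelSpace X]

open Classical in
/-- The counting measure on the points of `K` if `K` has `k` points, and zero otherwise. -/
noncomputable def pointCount (k : ℕ) (K : NonemptyCompacts X) : Measure X :=
  if (K : Set X).encard = k then Measure.count.restrict (K : Set X) else 0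

theorem pointCount_apply (k : ℕ) (K : NonemptyCompacts X) {B : Set X} (hB : MeasurableSet B) :
    pointCount k K B = if (K : Set X).encard = k then (((K : Set X) ∩ B).encard : ℝ≥0∞) else 0 := by
  unfold pointCount
  split_ifs with h
  · rw [Measure.restrict_apply hB, inter_comm,
      Measure.count_apply (K.isCompact.measurableSet.inter hB)]
  · rfl

theorem pointCount_univ (k : ℕ) (K : NonemptyCompacts X) :
    pointCount k K univ = {K : NonemptyCompacts X | (K : Set X).encard = k}.indicator
      (fun _ => (k : ℝ≥0∞)) K := by
  rw [pointCount_apply k K MeasurableSet.univ, inter_univ]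
  by_cases h : (K : Set X).encard = k <;> simp [h]

instance isFiniteMeasure_pointCount (k : ℕ) (K : NonemptyCompacts X) :
    IsFiniteMeasure (pointCount k K) := ⟨by
  rw [pointCount_univ]
  by_cases h : (K : Set X).encard = k <;> simp [h]⟩

theorem measurable_pointCount [CompactSpace X] [TotallyDisconnectedSpace X] (T : TreeStructure X)
    (k : ℕ) : Measurable (pointCount (X := X) k) := by
  have hk : MeasurableSet {K : NonemptyCompacts X | (K : Set X).encard = k} :=
    measurableSet_encard_eq T k
  refine Measurable.measure_of_isPiSystem (S := {U | IsClopen U})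
    ((BorelSpace.measurable_eq (α := X)).trans
      (isTopologicalBasis_isClopen (X := X)).borel_eq_generateFrom)
    (fun U hU V hV _ => hU.inter hV) (fun U hU => ?_) ?_
  · simp_rw [pointCount_apply k _ (IsClopen.isOpen hU).measurableSet]
    exact Measurable.ite hk ((measurable_from_top (f := fun m : ℕ∞ => (m : ℝ≥0∞))).comp
      (measurable_encard_inter T hU)) measurable_const
  · simp_rw [pointCount_univ]
    exact measurable_const.indicator hk

variable [MulAction G X] [ContinuousConstSMul G X]

theorem pointCount_smul (k : ℕ) (g : G) (K : NonemptyCompacts X) {B : Set X}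
    (hB : MeasurableSet B) :
    pointCount k (g • K) B = pointCount k K ((fun x => g • x) ⁻¹' B) := by
  have hinj := MulAction.injective (β := X) g
  rw [pointCount_apply k _ hB, pointCount_apply k _ (measurable_const_smul g hB),
    coe_smul_nonemptyCompacts, hinj.encard_image, ← image_inter_preimage, hinj.encard_image]

/-- The mean of `pointCount k` under `ν` is invariant, since `pointCount` is equivariant. Its total
mass, `k` times the probability of having `k` points, is finite and nonzero, so it can be
normalised. -/
theorem invariantProb_nonempty [CompactSpace X] [TotallyDisconnectedSpace X] (T : TreeStructure X)
    {ν : Measure (NonemptyCompacts X)} [IsFiniteMeasure ν]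
    [SMulInvariantMeasure G (NonemptyCompacts X) ν] {k : ℕ} (hk : k ≠ 0)
    (hν : ν {K | (K : Set X).encard = k} ≠ 0) : (invariantProb G X).Nonempty := by
  have hmeas := measurable_pointCount T k
  set μ := ν.bind (pointCount k)
  have hμ {B : Set X} (hB : MeasurableSet B) : μ B = ∫⁻ K, pointCount k K B ∂ν :=
    Measure.bind_apply hB hmeas.aemeasurable
  have huniv : μ univ = k * ν {K | (K : Set X).encard = k} := by
    rw [hμ MeasurableSet.univ]
    simp_rw [pointCount_univ]
    exact lintegral_indicator_const (measurableSet_encard_eq T k) _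
  have : IsFiniteMeasure μ := ⟨by rw [huniv]; finiteness⟩
  have : NeZero μ := ⟨fun h => by
    rw [h, Measure.coe_zero, Pi.zero_apply] at huniv
    simp [hk, hν] at huniv⟩
  have hinv : SMulInvariantMeasure G X μ := ⟨fun g B hB => by
    rw [hμ hB, hμ (measurable_const_smul g hB)]
    simp_rw [← pointCount_smul k g _ hB]
    have hpres : MeasurePreserving (fun K : NonemptyCompacts X => g • K) ν ν :=
      ⟨measurable_smul_nonemptyCompacts g, by
        ext E hE
        rw [Measure.map_apply (measurable_smul_nonemptyCompacts g) hE,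
          SMulInvariantMeasure.measure_preimage_smul g hE]⟩
    exact hpres.lintegral_comp (f := fun K => pointCount k K B)
      ((Measure.measurable_coe hB).comp hmeas)⟩
  exact ⟨(μ univ)⁻¹ • μ, isProbabilityMeasureSMul, inferInstance⟩

end Empirical

/-! ### Mixtures and recovery of their weights -/

section Mixture

variable {G X : Type*} [Group G] [MetricSpace X] [CompactSpace X] [Nonempty X]
  [MeasurableSpace X] {μ : Measure X}

/-- The mixture of `δ_X` and of the measures `muK μ k` with weights `c`. -/
noncomputable def mixture (μ : Measure X) (c : ℕ → ℝ≥0) : Measure (NonemptyCompacts X) :=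
  c 0 • diracWhole X + Measure.sum fun k : ℕ => c (k + 1) • muK μ (k + 1)

theorem mixture_apply (c : ℕ → ℝ≥0) {E : Set (NonemptyCompacts X)} (hE : MeasurableSet E) :
    mixture μ c E = c 0 * diracWhole X E + ∑' k : ℕ, c (k + 1) * muK μ (k + 1) E := by
  rw [mixture, Measure.add_apply, Measure.sum_apply _ hE]
  rfl

theorem mixture_smul_add_smul (s t : ℝ≥0) (c d : ℕ → ℝ≥0) :
    mixture μ (s • c + t • d) = s • mixture μ c + t • mixture μ d := by
  ext E hE
  simp only [Measure.coe_add, Measure.coe_nnreal_smul_apply, Pi.add_apply, mixture_apply _ hE,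
    Pi.smul_apply, smul_eq_mul, ENNReal.coe_add, ENNReal.coe_mul, add_mul, mul_add, mul_assoc,
    ENNReal.tsum_add, ENNReal.tsum_mul_left]
  exact add_add_add_comm _ _ _ _

variable [BorelSpace X] [TotallyDisconnectedSpace X]

theorem isProbabilityMeasure_mixture [IsProbabilityMeasure μ] {c : ℕ → ℝ≥0}
    (hc : c ∈ probSimplex) : IsProbabilityMeasure (mixture μ c) := ⟨by
  have h : ∑' k, (c k : ℝ≥0∞) = 1 := (ENNReal.hasSum_coe.2 hc).tsum_eq
  rw [mixture_apply c MeasurableSet.univ]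
  simp only [measure_univ, mul_one]
  rwa [tsum_eq_zero_add' ENNReal.summable] at h⟩

variable [MulAction G X]

theorem smulInvariantMeasure_mixture [ContinuousConstSMul G X] [IsProbabilityMeasure μ]
    [SMulInvariantMeasure G X μ] (c : ℕ → ℝ≥0) :
    SMulInvariantMeasure G (NonemptyCompacts X) (mixture μ c) where
  measure_preimage_smul g E hE := by
    simp only [mixture_apply c hE, mixture_apply c (measurable_smul_nonemptyCompacts g hE),
      SMulInvariantMeasure.measure_preimage_smul g hE]

theorem mixture_encard_eq [Infinite X] {T : TreeStructure X} (hT : DeeplyTransitiveWith G T)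
    [IsProbabilityMeasure μ] [SMulInvariantMeasure G X μ] (c : ℕ → ℝ≥0) (k : ℕ) :
    mixture μ c {K | (K : Set X).encard = (k + 1 : ℕ)} = c (k + 1) := by
  rw [mixture_apply c (measurableSet_encard_eq T _), diracWhole_encard_eq T]
  simp only [muK_encard_eq hT]
  rw [tsum_eq_single k fun j hj => by simp [hj]]
  simp

theorem injOn_mixture [Infinite X] {T : TreeStructure X} (hT : DeeplyTransitiveWith G T)
    [IsProbabilityMeasure μ] [SMulInvariantMeasure G X μ] :
    InjOn (mixture μ) probSimplex := by
  intro c hc d hd h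
  have hsucc (k : ℕ) : c (k + 1) = d (k + 1) := by
    rw [← ENNReal.coe_inj, ← mixture_encard_eq (μ := μ) hT, h, mixture_encard_eq hT]
  -- The finite cardinalities do not see the weight of `δ_X`; the total sum `1` recovers it.
  have h0 : c 0 = d 0 := by
    have h1 : ∑' k, c k = ∑' k, d k := hc.tsum_eq.trans hd.tsum_eq.symm
    rw [tsum_eq_zero_add' (NNReal.summable_nat_add c hc.summable 1),
      tsum_eq_zero_add' (NNReal.summable_nat_add d hd.summable 1)] at h1
    simpa only [hsucc, add_left_inj] using h1
  funext k
  cases k with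
  | zero => exact h0
  | succ k => exact hsucc k

end Mixture

/-! ### Classification of the invariant random compacts -/

section EncardLaw

variable {G X : Type*} [Group G] [MetricSpace X] {ν : Measure (NonemptyCompacts X)}

theorem measure_encard_eq_zero : ν {K | (K : Set X).encard = (0 : ℕ)} = 0 := by
  have : {K : NonemptyCompacts X | (K : Set X).encard = (0 : ℕ)} = ∅ := by
    ext K
    simp [K.nonempty.ne_empty]
  rw [this, measure_empty]

theorem measure_infinite_add_tsum (T : TreeStructure X) :
    ν {K | (K : Set X).encard = ⊤} + ∑' k : ℕ, ν {K | (K : Set X).encard = (k + 1 : ℕ)} =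
      ν univ := by
  have hd : Pairwise (Function.onFun Disjoint fun k : ℕ =>
      {K : NonemptyCompacts X | (K : Set X).encard = (k + 1 : ℕ)}) := by
    intro i j hij
    refine disjoint_left.2 fun K hi hj => hij ?_
    have : ((i + 1 : ℕ) : ℕ∞) = (j + 1 : ℕ) := Eq.trans (Eq.symm hi) hj
    rw [Nat.cast_inj] at this
    omega
  rw [← measure_iUnion hd fun k => measurableSet_encard_eq T _, ← measure_union
    (disjoint_left.2 fun K h h' => by
      obtain ⟨k, hk⟩ := mem_iUnion.1 h'
      exact ENat.natCast_ne_top _ (Eq.trans (Eq.symm hk) h))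
    (MeasurableSet.iUnion fun k => measurableSet_encard_eq T _)]
  congr 1
  refine eq_univ_of_forall fun K => ?_
  by_cases h : (K : Set X).encard = ⊤
  · exact Or.inl h
  · obtain ⟨k, hk⟩ := ENat.ne_top_iff_exists.1 h
    refine Or.inr (mem_iUnion.2 ⟨k - 1, ?_⟩)
    have : k ≠ 0 := by
      rintro rfl
      exact K.nonempty.ne_empty (encard_eq_zero.1 hk.symm)
    change (K : Set X).encard = (k - 1 + 1 : ℕ)
    rw [← hk, Nat.sub_add_cancel (Nat.one_le_iff_ne_zero.2 this)]

variable [CompactSpace X] [Nonempty X] [MulAction G X] [ContinuousConstSMul G X]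

theorem diracWhole_mem_invariantRandomCompacts :
    diracWhole X ∈ invariantRandomCompacts G X :=
  ⟨inferInstance, inferInstance⟩

theorem nonfinitary_diracWhole [Infinite X] (T : TreeStructure X) :
    Nonfinitary (diracWhole X) := by
  have hmeas : MeasurableSet {K : NonemptyCompacts X | (K : Set X).Infinite} := by
    simpa only [encard_eq_top_iff] using measurableSet_encard_eq T ⊤
  exact (ae_dirac_iff hmeas).2 (by simpa using infinite_univ)

variable [TotallyDisconnectedSpace X]

/-- The weights are the cardinality law of `ν` itself, with index `0` carrying the mass of the
infinite sets. -/
theorem exists_mixture_eq [Infinite X] [MeasurableSpace X] [BorelSpace X] {T : TreeStructure X}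
    (hT : DeeplyTransitiveWith G T) {μ : Measure X} [IsProbabilityMeasure μ]
    [SMulInvariantMeasure G X μ] [IsProbabilityMeasure ν]
    [SMulInvariantMeasure G (NonemptyCompacts X) ν] : ∃ c ∈ probSimplex, mixture μ c = ν := by
  let c : ℕ → ℝ≥0 := fun
    | 0 => (ν {K | (K : Set X).encard = ⊤}).toNNReal
    | k + 1 => (ν {K | (K : Set X).encard = (k + 1 : ℕ)}).toNNReal
  have hc0 : (c 0 : ℝ≥0∞) = ν {K | (K : Set X).encard = ⊤} :=
    ENNReal.coe_toNNReal (measure_ne_top ν _)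
  have hc1 (k : ℕ) : (c (k + 1) : ℝ≥0∞) = ν {K | (K : Set X).encard = (k + 1 : ℕ)} :=
    ENNReal.coe_toNNReal (measure_ne_top ν _)
  have hc : c ∈ probSimplex := by
    refine ENNReal.hasSum_coe.1 ?_
    rw [ENNReal.summable.hasSum_iff, tsum_eq_zero_add' ENNReal.summable, hc0]
    simp only [hc1]
    rw [measure_infinite_add_tsum T, measure_univ, ENNReal.coe_one]
  have := isProbabilityMeasure_mixture (μ := μ) hc
  have := smulInvariantMeasure_mixture (G := G) (μ := μ) c
  refine ⟨c, hc, eq_of_encard_law_eq hT fun r => ?_⟩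
  cases r with
  -- Cardinality `0` is impossible for nonempty compacts, which leaves index `0` free for `δ_X`.
  | zero => rw [measure_encard_eq_zero, measure_encard_eq_zero]
  | succ k => rw [mixture_encard_eq hT, hc1]

theorem eq_diracWhole [Infinite X] {T : TreeStructure X} (hT : DeeplyTransitiveWith G T)
    [IsProbabilityMeasure ν] [SMulInvariantMeasure G (NonemptyCompacts X) ν]
    (h : ∀ r : ℕ, ν {K | (K : Set X).encard = r} = 0) : ν = diracWhole X :=
  eq_of_encard_law_eq hT fun r => by rw [h r, diracWhole_encard_eq T]

theorem icRigid [Infinite X] {T : TreeStructure X} (hT : DeeplyTransitiveWith G T) :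
    ICRigid G X := by
  refine Subset.antisymm ?_ (singleton_subset_iff.2
    ⟨diracWhole_mem_invariantRandomCompacts, nonfinitary_diracWhole T⟩)
  rintro ν ⟨⟨_, _⟩, hν⟩
  refine eq_diracWhole hT fun r => measure_mono_null ?_ hν
  intro K hK hinf
  rw [mem_ofPred_eq, hinf.encard_eq] at hK
  exact ENat.top_ne_natCast r hK

theorem invariantRandomCompacts_eq_of_isEmpty [Infinite X] [MeasurableSpace X] [BorelSpace X]
    {T : TreeStructure X} (hT : DeeplyTransitiveWith G T) (h : invariantProb G X = ∅) :
    invariantRandomCompacts G X = {diracWhole X} := by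
  refine Subset.antisymm ?_ (singleton_subset_iff.2 diracWhole_mem_invariantRandomCompacts)
  rintro ν ⟨_, _⟩
  refine eq_diracWhole hT fun r => ?_
  rcases eq_or_ne r 0 with rfl | hr
  · exact measure_encard_eq_zero
  · by_contra hne
    exact (invariantProb_nonempty (G := G) T hr hne).ne_empty h

end EncardLaw

end IRC

theorem mainTheorem1 {G X : Type*} [Group G] [MetricSpace X] [CompactSpace X] [Nonempty X]
    [TotallyDisconnectedSpace X] [PerfectSpace X] [MeasurableSpace X] [BorelSpace X]
    [MulAction G X] [ContinuousConstSMul G X] (hG : IRC.DeeplyTransitive G X) :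
    IRC.ICRigid G X ∧
    (IRC.invariantProb G X = ∅ →
      IRC.invariantRandomCompacts G X = {IRC.diracWhole X}) ∧
    (∀ μ ∈ IRC.invariantProb G X,
      ∃ Φ : IRC.probSimplex ≃ IRC.invariantRandomCompacts G X,
        IRC.PreservesConvexComb Φ ∧
        ∀ c : IRC.probSimplex,
          (Φ c : Measure (NonemptyCompacts X)) =
            c.1 0 • IRC.diracWhole X +
              Measure.sum fun k : ℕ => c.1 (k + 1) • IRC.muK μ (k + 1)) := by
  obtain ⟨T, hT⟩ := hG
  have : Infinite X := by
    obtain ⟨x⟩ := ‹Nonempty X›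
    -- In a perfect metric space every neighbourhood of a point is infinite.
    exact infinite_univ_iff.1 (infinite_of_mem_nhds x univ_mem)
  refine ⟨IRC.icRigid hT, IRC.invariantRandomCompacts_eq_of_isEmpty hT, ?_⟩
  rintro μ ⟨_, _⟩
  let F : IRC.probSimplex → IRC.invariantRandomCompacts G X := fun c =>
    ⟨IRC.mixture μ c, IRC.isProbabilityMeasure_mixture c.2, IRC.smulInvariantMeasure_mixture _⟩
  have hF : Function.Bijective F := by
    refine ⟨fun c d h => Subtype.ext (IRC.injOn_mixture hT c.2 d.2 (congrArg Subtype.val h)), ?_⟩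
    rintro ⟨ν, _, _⟩
    obtain ⟨c, hc, h⟩ := IRC.exists_mixture_eq (ν := ν) (μ := μ) hT
    exact ⟨⟨c, hc⟩, Subtype.ext h⟩
  refine ⟨Equiv.ofBijective F hF, fun c d e s t _ h => ?_, fun c => rfl⟩
  change IRC.mixture μ e = s • IRC.mixture μ c + t • IRC.mixture μ d
  rw [h, IRC.mixture_smul_add_smul]
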